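/- Let $X$ be a real Banach space with dual $X^*$ and duality pairing $\langle\cdot,\cdot\rangle$. Let $K_1,\dots,K_m\subset X$ be convex and weakly compact, let $y_1,\dots,y_m\in\{-1,1\}$, and put $K=\prod_{i=1}^m K_i$, $I_+=\{i: y_i=1\}$, $I_-=\{i: y_i=-1\}$. For $C>0$ and $D>0$ consider the following problems. R-SVM($C$): minimize $\frac12\|w\|^2+C\sum_{i=1}^m\xi_i$ over $(w,b,\xi)\in X^*\times\mathbb R\times\mathbb R_+^m$ subject to $\min_{x_i\in K_i}y_i(\langle x_i,w\rangle+b)\ge 1-\xi_i$ for $i=1,\dots,m$. OD-R-SVM($C$): maximize $\sum_{i=1}^m\lambda_i-\frac12\big\|\sum_{i=1}^m\lambda_iy_ix_i\big\|^2$ over $(\lambda,x)\in\mathbb R_+^m\times K$ subject to $\sum_{i=1}^m\lambda_iy_i=0$ and $\lambda_i\le C$ for all $i$. R-CM($D$): minimize $\frac12\|w\|^2-(\alpha-\beta)+D\sum_{i=1}^m\xi_i$ over $(w,\alpha,\beta,\xi)\in X^*\times\mathbb R\times\mathbb R\times\mathbb R_+^m$ subject to $\min_{x_i\in K_i}\langle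 x_i,w\rangle\ge\alpha-\xi_i$ for $i\in I_+$ and $\max_{x_i\in K_i}\langle x_i,w\rangle\le\beta+\xi_i$ for $i\in I_-$. OD-R-CM($D$): maximize $-\frac12\big\|\sum_{i=1}^m\lambda_iy_ix_i\big\|^2$ over $(\lambda,x)\in\mathbb R_+^m\times K$ subject to $\sum_{i\in I_+}\lambda_i=\sum_{i\in I_-}\lambda_i=1$ and $\lambda_i\le D$ for all $i$. A solution of a pair consists of a solution of the first problem together with a solution of the second. For $\circ\in\{+,-\}$ let $$K_\circ(D)=\Big\{\sum_{i\in I_\circ}a_ix_i:\ x_i\in K_i,\ 0\le a_i\le D\ (i\in I_\circ),\ \sum_{i\in I_\circ}a_i=1\Big\}$$ be the reduced convex hulls, and let $\mathrm{dist}(A,B)=\inf_{p\in A,\,q\in B}\|p-q\|$. Then the following hold. 1. If $(\bar w,\bar b,\bar\xi;\bar\lambda,\bar x)$ is a solution of the pair R-SVM($C$)–OD-R-SVM($C$) with $\bar w\ne0$, then $\sigma:=\sum_{i=1}^m\bar\lambda_i>0$ and $$\Big(\frac{2\bar w}{\sigma},\frac{2(1-\bar b)}{\sigma},\frac{2(-1-\bar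 b)}{\sigma},\frac{2\bar\xi}{\sigma};\frac{2\bar\lambda}{\sigma},\bar x\Big)$$ is a solution of the pair R-CM($D$)–OD-R-CM($D$) with $D=2C/\sigma$. 2. If $(\bar w,\bar\alpha,\bar\beta,\bar\xi;\bar\lambda,\bar x)$ is a solution of the pair R-CM($D$)–OD-R-CM($D$) with $\bar w\neq0$, then $\bar\alpha-\bar\beta>0$ and $$\Big(\frac{2\bar w}{\bar\alpha-\bar\beta},-\frac{\bar\alpha+\bar\beta}{\bar\alpha-\bar\beta},\frac{2\bar\xi}{\bar\alpha-\bar\beta};\frac{2\bar\lambda}{\bar\alpha-\bar\beta},\bar x\Big)$$ is a solution of the pair R-SVM($C$)–OD-R-SVM($C$) with $C=2D/(\bar\alpha-\bar\beta)$. 3. For every $D>0$, OD-R-CM($D$) is the problem of finding nearest points of $K_+(D)$ and $K_-(D)$. That is: if both sets are nonempty, its optimal value (supremum) is $-\frac12\,\mathrm{dist}(K_+(D),K_-(D))^2$; a feasible $(\lambda,x)$ is a solution of OD-R-CM($D$) if and only if $p=\sum_{i\in I_+}\lambda_ix_i$ and $q=\sum_{i\in I_-}\lambda_ix_i$ satisfy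 $p\in K_+(D)$, $q\in K_-(D)$ and $\|p-q\|=\mathrm{dist}(K_+(D),K_-(D))$; and every such nearest pair $(p,q)$ arises in this way from a solution of OD-R-CM($D$). -/

import Mathlib

noncomputable section

namespace RobustSVM

variable {X : Type*} [NormedAddCommGroup X] [NormedSpace ℝ X] {m : ℕ}

/-- A subset of a normed space is weakly compact if it is compact for the weak topology
`σ(X, X*)`. -/
def WeaklyCompact (S : Set X) : Prop := IsCompact (toWeakSpace ℝ X '' S)

/-- `I₊`, the indices with label `+1`. -/
def posIdx (y : Fin m → ℝ) : Finset (Fin m) := {i | y i = 1}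

/-- `I₋`, the indices with label `-1`. -/
def negIdx (y : Fin m → ℝ) : Finset (Fin m) := {i | y i = -1}

/-! ### The soft-margin pair with parameter `C` -/

/-- Feasible `(w, b, ξ)` of the primal soft-margin problem. The constraint
`min_{x ∈ K i} y i * (⟨x, w⟩ + b) ≥ 1 - ξ i` is imposed for all realizations `x ∈ K i`. -/
def svmFeasible (K : Fin m → Set X) (y : Fin m → ℝ) :
    Set (StrongDual ℝ X × ℝ × (Fin m → ℝ)) :=
  {p | (∀ i, 0 ≤ p.2.2 i) ∧ ∀ i, ∀ x ∈ K i, 1 - p.2.2 i ≤ y i * (p.1 x + p.2.1)}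

/-- Objective `‖w‖² / 2 + C ∑ ξ i`. -/
def svmObj (C : ℝ) (p : StrongDual ℝ X × ℝ × (Fin m → ℝ)) : ℝ :=
  1 / 2 * ‖p.1‖ ^ 2 + C * ∑ i, p.2.2 i

/-- `(w, b, ξ)` is a solution of the primal soft-margin problem. -/
def IsSolSVM (K : Fin m → Set X) (y : Fin m → ℝ) (C : ℝ)
    (w : StrongDual ℝ X) (b : ℝ) (ξ : Fin m → ℝ) : Prop :=
  (w, b, ξ) ∈ svmFeasible K y ∧ IsMinOn (svmObj C) (svmFeasible K y) (w, b, ξ)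

/-- Feasible `(lam, x)` of the optimistic dual of the soft-margin problem. -/
def odSvmFeasible (K : Fin m → Set X) (y : Fin m → ℝ) (C : ℝ) :
    Set ((Fin m → ℝ) × (Fin m → X)) :=
  {q | (∀ i, 0 ≤ q.1 i) ∧ (∀ i, q.2 i ∈ K i) ∧ ∑ i, q.1 i * y i = 0 ∧ ∀ i, q.1 i ≤ C}

/-- Objective `∑ lam i - ‖∑ lam i y i x i‖² / 2`. -/
def odSvmObj (y : Fin m → ℝ) (q : (Fin m → ℝ) × (Fin m → X)) : ℝ :=
  ∑ i, q.1 i - 1 / 2 * ‖∑ i, (q.1 i * y i) • q.2 i‖ ^ 2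

/-- `(lam, x)` is a solution of the optimistic dual of the soft-margin problem. -/
def IsSolODSVM (K : Fin m → Set X) (y : Fin m → ℝ) (C : ℝ)
    (lam : Fin m → ℝ) (x : Fin m → X) : Prop :=
  (lam, x) ∈ odSvmFeasible K y C ∧ IsMaxOn (odSvmObj y) (odSvmFeasible K y C) (lam, x)

/-! ### The relaxed C-margin pair with parameter `D` -/

/-- Feasible `(w, α, β, ξ)` of the primal relaxed C-margin problem. -/
def cmFeasible (K : Fin m → Set X) (y : Fin m → ℝ) :
    Set (StrongDual ℝ X × ℝ × ℝ × (Fin m → ℝ)) :=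
  {p | (∀ i, 0 ≤ p.2.2.2 i) ∧
    (∀ i ∈ posIdx y, ∀ x ∈ K i, p.2.1 - p.2.2.2 i ≤ p.1 x) ∧
    (∀ i ∈ negIdx y, ∀ x ∈ K i, p.1 x ≤ p.2.2.1 + p.2.2.2 i)}

/-- Objective `‖w‖² / 2 - (α - β) + D ∑ ξ i`. -/
def cmObj (D : ℝ) (p : StrongDual ℝ X × ℝ × ℝ × (Fin m → ℝ)) : ℝ :=
  1 / 2 * ‖p.1‖ ^ 2 - (p.2.1 - p.2.2.1) + D * ∑ i, p.2.2.2 i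

/-- `(w, α, β, ξ)` is a solution of the primal relaxed C-margin problem. -/
def IsSolCM (K : Fin m → Set X) (y : Fin m → ℝ) (D : ℝ)
    (w : StrongDual ℝ X) (α β : ℝ) (ξ : Fin m → ℝ) : Prop :=
  (w, α, β, ξ) ∈ cmFeasible K y ∧ IsMinOn (cmObj D) (cmFeasible K y) (w, α, β, ξ)

/-- Feasible `(lam, x)` of the optimistic dual of the relaxed C-margin problem. -/
def odCmFeasible (K : Fin m → Set X) (y : Fin m → ℝ) (D : ℝ) :
    Set ((Fin m → ℝ) × (Fin m → X)) :=
  {q | (∀ i, 0 ≤ q.1 i) ∧ (∀ i, q.2 i ∈ K i) ∧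
    ∑ i ∈ posIdx y, q.1 i = 1 ∧ ∑ i ∈ negIdx y, q.1 i = 1 ∧ ∀ i, q.1 i ≤ D}

/-- Objective `-‖∑ lam i y i x i‖² / 2`. -/
def odCmObj (y : Fin m → ℝ) (q : (Fin m → ℝ) × (Fin m → X)) : ℝ :=
  -(1 / 2 * ‖∑ i, (q.1 i * y i) • q.2 i‖ ^ 2)

/-- `(lam, x)` is a solution of the optimistic dual of the relaxed C-margin problem. -/
def IsSolODCM (K : Fin m → Set X) (y : Fin m → ℝ) (D : ℝ)
    (lam : Fin m → ℝ) (x : Fin m → X) : Prop :=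
  (lam, x) ∈ odCmFeasible K y D ∧ IsMaxOn (odCmObj y) (odCmFeasible K y D) (lam, x)

/-! ### Reduced convex hulls and their distance -/

/-- The reduced convex hull, with weights at most `D`, of the sets `K i`, `i ∈ J`. -/
def reducedHull (K : Fin m → Set X) (J : Finset (Fin m)) (D : ℝ) : Set X :=
  {p | ∃ (a : Fin m → ℝ) (x : Fin m → X),
    (∀ i ∈ J, x i ∈ K i ∧ 0 ≤ a i ∧ a i ≤ D) ∧ ∑ i ∈ J, a i = 1 ∧ p = ∑ i ∈ J, a i • x i}

/-- `dist(A, B) = inf {‖p - q‖ : p ∈ A, q ∈ B}` (used for nonempty `A`, `B`). -/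
def setDist (A B : Set X) : ℝ := sInf {r | ∃ p ∈ A, ∃ q ∈ B, r = ‖p - q‖}

/-- `(p, q)` is a pair of nearest points of `A` and `B`. -/
def IsNearestPair (A B : Set X) (p q : X) : Prop :=
  p ∈ A ∧ q ∈ B ∧ ‖p - q‖ = setDist A B

end RobustSVM

end

/-! Both correspondences rest on a zero duality gap. Weak duality (`odSvmObj_le_svmObj`,
`odCmObj_le_cmObj`) means that a feasible primal-dual pair with nonpositive gap is optimal on both
sides. The rescaling preserves feasibility and multiplies the gap by the square of the scaling
factor, so it carries zero-gap pairs to zero-gap pairs; `w ≠ 0` makes the divisor positive.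

What needs work is that arbitrary solutions of a pair have zero gap (`exists_svmObj_le_odSvmObj`,
`exists_cmObj_le_odCmObj`). Convexity of the `K i` makes the attainable values of `∑ (lam i * y i) •
x i` a convex set, although the expression is bilinear. Hahn-Banach then gives a functional `w`
certifying the dual optimum. Weak compactness provides worst-case realizations for `w`; with these
frozen, `lam` solves a linear program with box constraints, whose multipliers are the offsets
missing from the primal point.

The nearest-point statement needs no duality: dual feasible points represent exactly the pairs of
points of the two reduced hulls, and the objective is minus half their squared distance. -/

namespace RobustSVM

open Finset

/-! ### Convex duality and multipliers of a box-constrained linear program -/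

section General

variable {X : Type*} [NormedAddCommGroup X] [NormedSpace ℝ X] {m : ℕ}

/-- A continuous functional attains its minimum on a nonempty weakly compact set. -/
lemma WeaklyCompact.exists_forall_le {S : Set X} (hS : WeaklyCompact S) (hne : S.Nonempty)
    (w : StrongDual ℝ X) : ∃ z ∈ S, ∀ x ∈ S, w z ≤ w x := by
  have hc : Continuous fun x : WeakSpace ℝ X => w ((toWeakSpace ℝ X).symm x) :=
    WeakBilin.eval_continuous (topDualPairing ℝ X).flip w
  obtain ⟨_, ⟨z, hz, rfl⟩, h⟩ := hS.exists_isMinOn (hne.image _) hc.continuousOn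
  refine ⟨z, hz, fun x hx => ?_⟩
  have := h (Set.mem_image_of_mem _ hx)
  simpa using this

/-- Half the squared dual norm is at most the conjugate of `‖u‖² / 2`. Testing `h` on the best
multiple of each direction bounds `w u` by `√(2 * N) * ‖u‖`, so the norm need not be attained. -/
lemma StrongDual.half_norm_sq_le (w : StrongDual ℝ X) (N : ℝ)
    (h : ∀ u, w u - 1 / 2 * ‖u‖ ^ 2 ≤ N) : 1 / 2 * ‖w‖ ^ 2 ≤ N := by
  have hN : 0 ≤ N := by simpa using h 0
  have hw : ‖w‖ ≤ √(2 * N) := by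
    refine w.opNorm_le_bound (Real.sqrt_nonneg _) fun u => ?_
    rcases eq_or_ne u 0 with rfl | hu
    · simp
    have hu' : 0 < ‖u‖ := norm_pos_iff.2 hu
    have key := h ((w u / ‖u‖ ^ 2) • u)
    rw [map_smul, norm_smul, smul_eq_mul, Real.norm_eq_abs, mul_pow, sq_abs] at key
    have e : w u / ‖u‖ ^ 2 * w u - 1 / 2 * ((w u / ‖u‖ ^ 2) ^ 2 * ‖u‖ ^ 2)
        = (w u) ^ 2 / (2 * ‖u‖ ^ 2) := by
      field_simp
      ring
    rw [e, div_le_iff₀ (by positivity)] at key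
    rw [Real.norm_eq_abs]
    refine abs_le_of_sq_le_sq ?_ (by positivity)
    rw [mul_pow, Real.sq_sqrt (by positivity)]
    linarith
  have := pow_le_pow_left₀ (norm_nonneg w) hw 2
  rw [Real.sq_sqrt (by positivity)] at this
  linarith

lemma StrongDual.apply_le_half_norm_sq (w : StrongDual ℝ X) (v : X) :
    w v ≤ 1 / 2 * ‖w‖ ^ 2 + 1 / 2 * ‖v‖ ^ 2 := by
  have h1 : w v ≤ ‖w‖ * ‖v‖ := (le_abs_self _).trans (w.le_opNorm v)
  nlinarith [sq_nonneg (‖w‖ - ‖v‖)]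

/-- Fenchel duality for maximizing `s - ‖u‖² / 2` over a convex set. -/
lemma exists_dual_of_convex {S : Set (ℝ × X)} (hS : Convex ℝ S) {σ : ℝ} {v : X}
    (hmem : (σ, v) ∈ S) (hmax : ∀ q ∈ S, q.1 - 1 / 2 * ‖q.2‖ ^ 2 ≤ σ - 1 / 2 * ‖v‖ ^ 2) :
    ∃ w : StrongDual ℝ X, ∀ q ∈ S,
      q.1 - w q.2 + 1 / 2 * ‖w‖ ^ 2 ≤ σ - 1 / 2 * ‖v‖ ^ 2 := by
  set M := σ - 1 / 2 * ‖v‖ ^ 2 with hM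
  -- This strict epigraph consists of the points with objective value above `M`; maximality makes it
  -- disjoint from `S`.
  have hUconv : Convex ℝ {q : ℝ × X | M + 1 / 2 * ‖q.2‖ ^ 2 < q.1} := by
    rintro ⟨s, u⟩ h1 ⟨t, z⟩ h2 a b ha hb hab
    simp only [Set.mem_ofPred_eq, Prod.smul_mk, Prod.mk_add_mk, smul_eq_mul] at h1 h2 ⊢
    have h3 : ‖a • u + b • z‖ ≤ a * ‖u‖ + b * ‖z‖ := by
      refine (norm_add_le _ _).trans ?_
      rw [norm_smul_of_nonneg ha, norm_smul_of_nonneg hb]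
    have h4 := pow_le_pow_left₀ (norm_nonneg _) h3 2
    have h5 : (a * ‖u‖ + b * ‖z‖) ^ 2 ≤ a * ‖u‖ ^ 2 + b * ‖z‖ ^ 2 := by
      obtain rfl : b = 1 - a := by linarith
      nlinarith [mul_nonneg (mul_nonneg ha hb) (sq_nonneg (‖u‖ - ‖z‖))]
    have h6 : a * (M + 1 / 2 * ‖u‖ ^ 2) + b * (M + 1 / 2 * ‖z‖ ^ 2) < a * s + b * t := by
      rcases ha.eq_or_lt with rfl | ha'
      · obtain rfl : b = 1 := by linarith
        linarith
      · exact add_lt_add_of_lt_of_le (mul_lt_mul_of_pos_left h1 ha')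
          (mul_le_mul_of_nonneg_left h2.le hb)
    have h7 : a * M + b * M = M := by rw [← add_mul, hab, one_mul]
    linarith
  have hUopen : IsOpen {q : ℝ × X | M + 1 / 2 * ‖q.2‖ ^ 2 < q.1} :=
    isOpen_lt (by fun_prop) (by fun_prop)
  have hdisj : Disjoint {q : ℝ × X | M + 1 / 2 * ‖q.2‖ ^ 2 < q.1} S := by
    rw [Set.disjoint_left]
    intro q h1 h2
    have := hmax q h2
    simp only [Set.mem_ofPred_eq] at h1
    linarith
  obtain ⟨f, c, hU, hSc⟩ := geometric_hahn_banach_open hUconv hUopen hS hdisj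
  set a : ℝ := f (1, 0) with ha
  set g : StrongDual ℝ X := f.comp (ContinuousLinearMap.inr ℝ ℝ X) with hg
  have hf : ∀ s u, f (s, u) = s * a + g u := by
    intro s u
    have : ((s, u) : ℝ × X) = s • ((1, 0) : ℝ × X) + (0, u) := by simp
    rw [this, map_add, map_smul]
    rfl
  have hU' : ∀ s u, M + 1 / 2 * ‖u‖ ^ 2 < s → s * a + g u < c := fun s u h => by
    rw [← hf]; exact hU (s, u) h
  have hv : c ≤ σ * a + g v := by rw [← hf]; exact hSc _ hmem
  -- The hyperplane is not vertical: `(σ + 1, v)` lies in the open set, directly above `(σ, v) ∈ S`.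
  have ha0 : a < 0 := by
    have := hU' (σ + 1) v (by linarith)
    linarith
  refine ⟨(-a)⁻¹ • g, ?_⟩
  have hna : 0 < -a := by linarith
  -- Letting `ε` tend to `0` moves the separation inequality to the boundary of the epigraph, where
  -- it bounds the conjugate of `‖u‖² / 2` at the normalized functional.
  have hlow : 1 / 2 * ‖(-a)⁻¹ • g‖ ^ 2 ≤ M + (-a)⁻¹ * c := by
    refine StrongDual.half_norm_sq_le _ _ fun u => ?_
    refine le_of_forall_pos_le_add fun ε hε => ?_
    have h := hU' (M + 1 / 2 * ‖u‖ ^ 2 + ε) u (by linarith)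
    have h' := mul_lt_mul_of_pos_left h (inv_pos.2 hna)
    have e : (-a)⁻¹ * ((M + 1 / 2 * ‖u‖ ^ 2 + ε) * a + g u)
        = -(M + 1 / 2 * ‖u‖ ^ 2 + ε) + (-a)⁻¹ * g u := by
      have := ha0.ne
      field_simp
      ring
    rw [e] at h'
    simp only [smul_apply, smul_eq_mul]
    linarith
  rintro ⟨s, u⟩ hq
  have h := hSc _ hq
  rw [hf] at h
  have h' := mul_le_mul_of_nonneg_left h (inv_pos.2 hna).le
  have e : (-a)⁻¹ * (s * a + g u) = -s + (-a)⁻¹ * g u := by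
    have := ha0.ne
    field_simp
    ring
  rw [e] at h'
  simp only [smul_apply, smul_eq_mul]
  linarith

/-- Fenchel duality for the optimistic dual problems: a maximizer over weights in a convex set
`Λ` and realizations in `K` yields a functional certifying optimality. -/
lemma exists_dual_of_isMax {K : Fin m → Set X} {y : Fin m → ℝ} (hconv : ∀ i, Convex ℝ (K i))
    {Λ : Set (Fin m → ℝ)} (hΛ : Convex ℝ Λ) (hΛ0 : ∀ μ ∈ Λ, ∀ i, 0 ≤ μ i) (k : ℝ)
    {lam : Fin m → ℝ} {x : Fin m → X} (hlam : lam ∈ Λ) (hx : ∀ i, x i ∈ K i)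
    (hmax : ∀ μ ∈ Λ, ∀ z : Fin m → X, (∀ i, z i ∈ K i) →
      k * ∑ i, μ i - 1 / 2 * ‖∑ i, (μ i * y i) • z i‖ ^ 2 ≤
        k * ∑ i, lam i - 1 / 2 * ‖∑ i, (lam i * y i) • x i‖ ^ 2) :
    ∃ w : StrongDual ℝ X, ∀ μ ∈ Λ, ∀ z : Fin m → X, (∀ i, z i ∈ K i) →
      k * ∑ i, μ i - ∑ i, μ i * y i * w (z i) + 1 / 2 * ‖w‖ ^ 2 ≤
        k * ∑ i, lam i - 1 / 2 * ‖∑ i, (lam i * y i) • x i‖ ^ 2 := by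
  have hS : Convex ℝ {q : ℝ × X | ∃ μ ∈ Λ, ∃ z : Fin m → X, (∀ i, z i ∈ K i) ∧
      q = (k * ∑ i, μ i, ∑ i, (μ i * y i) • z i)} := by
    rintro _ ⟨μ, hμ, z, hz, rfl⟩ _ ⟨ν, hν, t, ht, rfl⟩ a b ha hb hab
    -- A combination of `μ i • z i` and `ν i • t i` with nonnegative weights is again a weight times
    -- a point of the convex set `K i`, even if the total weight vanishes.
    have h : ∀ i, ∃ r ∈ K i,
        (a * μ i + b * ν i) • r = (a * μ i) • z i + (b * ν i) • t i := fun i =>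
      (hconv i).exists_mem_add_smul_eq (hz i) (ht i) (mul_nonneg ha (hΛ0 μ hμ i))
        (mul_nonneg hb (hΛ0 ν hν i))
    choose r hr hre using h
    refine ⟨a • μ + b • ν, hΛ hμ hν ha hb hab, r, hr, ?_⟩
    simp only [Prod.smul_mk, Prod.mk_add_mk, smul_eq_mul, Prod.mk.injEq, Pi.add_apply,
      Pi.smul_apply]
    constructor
    · rw [sum_add_distrib, ← mul_sum, ← mul_sum]
      ring
    · rw [smul_sum, smul_sum, ← sum_add_distrib]
      refine sum_congr rfl fun i _ => ?_
      rw [mul_comm (a * μ i + b * ν i), mul_smul (y i) _ (r i), hre]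
      simp only [smul_add, smul_smul]
      congr 2 <;> ring
  obtain ⟨w, hw⟩ := exists_dual_of_convex hS (σ := k * ∑ i, lam i)
    (v := ∑ i, (lam i * y i) • x i) ⟨lam, hlam, x, hx, rfl⟩ (by
      rintro _ ⟨μ, hμ, z, hz, rfl⟩
      exact hmax μ hμ z hz)
  refine ⟨w, fun μ hμ z hz => ?_⟩
  have := hw _ ⟨μ, hμ, z, hz, rfl⟩
  simpa [map_sum] using this

/-- Two finite families with pairwise comparable values can be separated by a number. -/
lemma exists_between_of_finset {ι : Type*} (A B : Finset ι) (f : ι → ℝ)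
    (h : ∀ i ∈ A, ∀ j ∈ B, f i ≤ f j) : ∃ b, (∀ i ∈ A, f i ≤ b) ∧ ∀ j ∈ B, b ≤ f j := by
  rcases A.eq_empty_or_nonempty with rfl | hA
  · rcases B.eq_empty_or_nonempty with rfl | hB
    · exact ⟨0, by simp⟩
    · obtain ⟨j, _, hj⟩ := B.exists_min_image f hB
      exact ⟨f j, by simp, hj⟩
  · obtain ⟨i, hi, hi'⟩ := A.exists_max_image f hA
    exact ⟨f i, hi', h i hi⟩

/-- Lagrange multiplier for a linear program with box constraints and one balance constraint
on the coordinates in `J`. -/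
lemma exists_multiplier {y c lam : Fin m → ℝ} {D : ℝ} (hy : ∀ i, y i = 1 ∨ y i = -1)
    (J : Finset (Fin m)) (h0 : ∀ i, 0 ≤ lam i) (hD : ∀ i, lam i ≤ D)
    (hopt : ∀ μ : Fin m → ℝ, (∀ i, 0 ≤ μ i) → (∀ i, μ i ≤ D) → (∀ i ∉ J, μ i = lam i) →
      ∑ i ∈ J, μ i * y i = ∑ i ∈ J, lam i * y i → ∑ i, μ i * c i ≤ ∑ i, lam i * c i) :
    ∃ b, ∀ i ∈ J, D * max (c i - y i * b) 0 = lam i * (c i - y i * b) := by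
  classical
  have hyy : ∀ i, y i * y i = 1 := fun i => by rcases hy i with h | h <;> simp [h]
  -- The two sets collect the indices whose weight can move by `ε * y i`, respectively `-ε * y i`,
  -- inside the box. Moving one index of each kind by the same amount keeps the balance because `y i
  -- * y i = 1`, so optimality compares `y i * c i` with `y j * c j`; `b` is a number in between.
  obtain ⟨b, hA, hB⟩ := exists_between_of_finset
    {i ∈ J | ∃ ε > 0, 0 ≤ lam i + ε * y i ∧ lam i + ε * y i ≤ D}
    {i ∈ J | ∃ ε > 0, 0 ≤ lam i - ε * y i ∧ lam i - ε * y i ≤ D} (fun i => y i * c i) (by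
      intro i hi j hj
      obtain ⟨hiJ, ε, hε, hi0, hi1⟩ := mem_filter.1 hi
      obtain ⟨hjJ, δ, hδ, hj0, hj1⟩ := mem_filter.1 hj
      rcases eq_or_ne i j with rfl | hij
      · exact le_rfl
      set η := min ε δ with hη
      have hη0 : 0 < η := lt_min hε hδ
      have hηε : η ≤ ε := min_le_left _ _
      have hηδ : η ≤ δ := min_le_right _ _
      let μ : Fin m → ℝ := lam + Pi.single i (η * y i) - Pi.single j (η * y j)
      have hμ : ∀ k, 0 ≤ μ k ∧ μ k ≤ D := by
        intro k
        by_cases hki : k = i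
        · subst hki
          have : μ k = lam k + η * y k := by simp [μ, hij]
          rw [this]
          have := h0 k
          have := hD k
          rcases hy k with h | h <;> rw [h] at hi0 hi1 ⊢ <;> constructor <;> linarith
        · by_cases hkj : k = j
          · subst hkj
            have : μ k = lam k - η * y k := by simp [μ, hki]
            rw [this]
            have := h0 k
            have := hD k
            rcases hy k with h | h <;> rw [h] at hj0 hj1 ⊢ <;> constructor <;> linarith
          · have : μ k = lam k := by simp [μ, hki, hkj]
            rw [this]
            exact ⟨h0 k, hD k⟩
      have hsum : ∀ (T : Finset (Fin m)) (a : Fin m → ℝ), i ∈ T → j ∈ T →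
          ∑ k ∈ T, μ k * a k
            = ∑ k ∈ T, lam k * a k + η * (y i * a i) - η * (y j * a j) := by
        intro T a hi hj
        simp only [μ, Pi.sub_apply, Pi.add_apply, sub_mul, add_mul, sum_sub_distrib,
          sum_add_distrib, Pi.single_apply, ite_mul, zero_mul, sum_ite_eq', hi, hj, if_true,
          mul_assoc]
      have := hopt μ (fun k => (hμ k).1) (fun k => (hμ k).2)
        (fun k hk => by
          have h1 : k ≠ i := fun h => hk (h ▸ hiJ)
          have h2 : k ≠ j := fun h => hk (h ▸ hjJ)
          simp [μ, h1, h2])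
        (by rw [hsum J y hiJ hjJ, hyy, hyy]; ring)
      rw [hsum univ c (mem_univ _) (mem_univ _)] at this
      have : η * (y i * c i) ≤ η * (y j * c j) := by linarith
      exact le_of_mul_le_mul_left this hη0)
  refine ⟨b, fun i hi => ?_⟩
  have up : ∀ ε > 0, 0 ≤ lam i + ε * y i → lam i + ε * y i ≤ D → y i * c i ≤ b :=
    fun ε h1 h2 h3 => hA i (mem_filter.2 ⟨hi, ε, h1, h2, h3⟩)
  have down : ∀ ε > 0, 0 ≤ lam i - ε * y i → lam i - ε * y i ≤ D → b ≤ y i * c i :=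
    fun ε h1 h2 h3 => hB i (mem_filter.2 ⟨hi, ε, h1, h2, h3⟩)
  -- Complementary slackness: room above or below `lam i` fixes the sign of the reduced cost.
  have hlt : lam i < D → c i - y i * b ≤ 0 := by
    intro h
    have := h0 i
    rcases hy i with e | e <;> rw [e] at up down ⊢
    · have := up (D - lam i) (by linarith) (by linarith) (by linarith)
      linarith
    · have := down (D - lam i) (by linarith) (by linarith) (by linarith)
      linarith
  have hpos : 0 < lam i → 0 ≤ c i - y i * b := by
    intro h
    have := hD i
    rcases hy i with e | e <;> rw [e] at up down ⊢
    · have := down (lam i) (by linarith) (by linarith) (by linarith)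
      linarith
    · have := up (lam i) (by linarith) (by linarith) (by linarith)
      linarith
  rcases (hD i).eq_or_lt with h | h
  · rcases (h0 i).eq_or_lt with h' | h'
    · rw [← h, ← h']
      ring
    · rw [max_eq_left (hpos h'), h]
  · rw [max_eq_right (hlt h)]
    rcases (h0 i).eq_or_lt with h' | h'
    · rw [← h']
      ring
    · rw [le_antisymm (hlt h) (hpos h')]
      ring

end General

/-! ### Splitting sums by label -/

section Labels

variable {m : ℕ} {y : Fin m → ℝ}

lemma mem_posIdx {i : Fin m} : i ∈ posIdx y ↔ y i = 1 := by simp [posIdx]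

lemma mem_negIdx {i : Fin m} : i ∈ negIdx y ↔ y i = -1 := by simp [negIdx]

lemma sum_posIdx_add_sum_negIdx {M : Type*} [AddCommMonoid M] (hy : ∀ i, y i = 1 ∨ y i = -1)
    (f : Fin m → M) : ∑ i ∈ posIdx y, f i + ∑ i ∈ negIdx y, f i = ∑ i, f i := by
  have : negIdx y = univ.filter fun i => ¬ y i = 1 := by
    ext i
    rw [mem_negIdx, mem_filter]
    rcases hy i with h | h <;> norm_num [h]
  rw [this]
  exact sum_filter_add_sum_filter_not univ _ f

lemma sum_mul_label (hy : ∀ i, y i = 1 ∨ y i = -1) (f : Fin m → ℝ) :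
    ∑ i, f i * y i = ∑ i ∈ posIdx y, f i - ∑ i ∈ negIdx y, f i := by
  rw [← sum_posIdx_add_sum_negIdx hy, sub_eq_add_neg, ← sum_neg_distrib]
  congr 1
  · exact sum_congr rfl fun i hi => by rw [mem_posIdx.1 hi, mul_one]
  · exact sum_congr rfl fun i hi => by rw [mem_negIdx.1 hi, mul_neg_one]

lemma sum_mul_label_smul {X : Type*} [AddCommGroup X] [Module ℝ X]
    (hy : ∀ i, y i = 1 ∨ y i = -1) (f : Fin m → ℝ) (x : Fin m → X) :
    ∑ i, (f i * y i) • x i = ∑ i ∈ posIdx y, f i • x i - ∑ i ∈ negIdx y, f i • x i := by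
  rw [← sum_posIdx_add_sum_negIdx hy, sub_eq_add_neg, ← sum_neg_distrib]
  congr 1
  · exact sum_congr rfl fun i hi => by rw [mem_posIdx.1 hi, mul_one]
  · exact sum_congr rfl fun i hi => by rw [mem_negIdx.1 hi, mul_neg_one, neg_smul]

end Labels

/-! ### Weak and strong duality, and rescaling between the pairs -/

section Duality

variable {X : Type*} [NormedAddCommGroup X] [NormedSpace ℝ X] {m : ℕ}
  {K : Fin m → Set X} {y : Fin m → ℝ}

/-- Weak duality for the soft-margin pair. -/
lemma odSvmObj_le_svmObj {C : ℝ} {q : (Fin m → ℝ) × (Fin m → X)}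
    {p : StrongDual ℝ X × ℝ × (Fin m → ℝ)} (hq : q ∈ odSvmFeasible K y C)
    (hp : p ∈ svmFeasible K y) : odSvmObj y q ≤ svmObj C p := by
  obtain ⟨h0, hx, hs, hC⟩ := hq
  obtain ⟨hξ, hc⟩ := hp
  have h1 : ∑ i, q.1 i ≤ ∑ i, (q.1 i * y i * p.1 (q.2 i) + p.2.1 * (q.1 i * y i)
      + C * p.2.2 i) := by
    refine sum_le_sum fun i _ => ?_
    have := mul_le_mul_of_nonneg_left (hc i _ (hx i)) (h0 i)
    have := mul_le_mul_of_nonneg_right (hC i) (hξ i)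
    linarith
  rw [sum_add_distrib, sum_add_distrib, ← mul_sum, ← mul_sum, hs] at h1
  have h2 := StrongDual.apply_le_half_norm_sq p.1 (∑ i, (q.1 i * y i) • q.2 i)
  simp only [map_sum, map_smul, smul_eq_mul] at h2
  simp only [odSvmObj, svmObj]
  linarith

/-- Weak duality for the relaxed C-margin pair. -/
lemma odCmObj_le_cmObj (hy : ∀ i, y i = 1 ∨ y i = -1) {D : ℝ}
    {q : (Fin m → ℝ) × (Fin m → X)} {p : StrongDual ℝ X × ℝ × ℝ × (Fin m → ℝ)}
    (hq : q ∈ odCmFeasible K y D) (hp : p ∈ cmFeasible K y) : odCmObj y q ≤ cmObj D p := by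
  obtain ⟨h0, hx, hs1, hs2, hD⟩ := hq
  obtain ⟨hξ, hc1, hc2⟩ := hp
  have h1 : ∑ i ∈ posIdx y, p.2.1 * q.1 i ≤ ∑ i ∈ posIdx y, (q.1 i * y i * p.1 (q.2 i)
      + D * p.2.2.2 i) := by
    refine sum_le_sum fun i hi => ?_
    have := mul_le_mul_of_nonneg_left (hc1 i hi _ (hx i)) (h0 i)
    have := mul_le_mul_of_nonneg_right (hD i) (hξ i)
    rw [mem_posIdx.1 hi]
    linarith
  have h2 : ∑ i ∈ negIdx y, -p.2.2.1 * q.1 i ≤ ∑ i ∈ negIdx y, (q.1 i * y i * p.1 (q.2 i)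
      + D * p.2.2.2 i) := by
    refine sum_le_sum fun i hi => ?_
    have := mul_le_mul_of_nonneg_left (hc2 i hi _ (hx i)) (h0 i)
    have := mul_le_mul_of_nonneg_right (hD i) (hξ i)
    rw [mem_negIdx.1 hi]
    linarith
  have h3 := add_le_add h1 h2
  rw [sum_posIdx_add_sum_negIdx hy, ← mul_sum, ← mul_sum, hs1, hs2, sum_add_distrib,
    ← mul_sum] at h3
  have h4 := StrongDual.apply_le_half_norm_sq p.1 (∑ i, (q.1 i * y i) • q.2 i)
  simp only [map_sum, map_smul, smul_eq_mul] at h4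
  simp only [odCmObj, cmObj]
  linarith

/-- The labelled functional attains its minimum on each nonempty weakly compact `K i`. -/
lemma exists_forall_label_mul_le (hcomp : ∀ i, WeaklyCompact (K i)) (hne : ∀ i, (K i).Nonempty)
    (w : StrongDual ℝ X) :
    ∃ z : Fin m → X, (∀ i, z i ∈ K i) ∧ ∀ i, ∀ x ∈ K i, y i * w (z i) ≤ y i * w x := by
  have h := fun i => (hcomp i).exists_forall_le (hne i) (y i • w)
  choose z hz hz' using h
  exact ⟨z, hz, fun i x hx => by simpa using hz' i x hx⟩

/-- Strong duality for the soft-margin pair. -/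
lemma exists_svmObj_le_odSvmObj (hy : ∀ i, y i = 1 ∨ y i = -1) (hconv : ∀ i, Convex ℝ (K i))
    (hcomp : ∀ i, WeaklyCompact (K i)) {C : ℝ} {lam : Fin m → ℝ} {x : Fin m → X}
    (hsol : IsSolODSVM K y C lam x) :
    ∃ p ∈ svmFeasible K y, svmObj C p ≤ odSvmObj y (lam, x) := by
  obtain ⟨⟨h0, hx, hs, hC⟩, hmax⟩ := hsol
  simp only at h0 hx hs hC
  have hΛ : Convex ℝ {μ : Fin m → ℝ | (∀ i, 0 ≤ μ i) ∧ ∑ i, μ i * y i = 0 ∧ ∀ i, μ i ≤ C} := by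
    rintro μ ⟨m1, m2, m3⟩ ν ⟨n1, n2, n3⟩ a b ha hb hab
    refine ⟨fun i => ?_, ?_, fun i => ?_⟩
    · exact add_nonneg (mul_nonneg ha (m1 i)) (mul_nonneg hb (n1 i))
    · simp only [Pi.add_apply, Pi.smul_apply, smul_eq_mul, add_mul, mul_assoc, sum_add_distrib,
        ← mul_sum, m2, n2]
      simp
    · have : a * μ i + b * ν i ≤ a * C + b * C := by gcongr; exacts [m3 i, n3 i]
      rw [← add_mul, hab, one_mul] at this
      exact this
  obtain ⟨w, hw⟩ := exists_dual_of_isMax (y := y) hconv hΛ (fun μ h => h.1) 1 ⟨h0, hs, hC⟩ hx (by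
    rintro μ ⟨m1, m2, m3⟩ z hz
    have := hmax (show (μ, z) ∈ odSvmFeasible K y C from ⟨m1, hz, m2, m3⟩)
    simpa [odSvmObj] using this)
  obtain ⟨z, hz, hzmin⟩ := exists_forall_label_mul_le (y := y) hcomp (fun i => ⟨x i, hx i⟩) w
  have hval : ∀ μ : Fin m → ℝ, ∑ i, μ i * (1 - y i * w (z i))
      = ∑ i, μ i - ∑ i, μ i * y i * w (z i) := fun μ => by
    rw [← sum_sub_distrib]
    exact sum_congr rfl fun i _ => by ring
  -- With Fenchel-Young, this shows that `lam`, even with `x` replaced by the worst case `z`,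
  -- reaches the bound in `hw`. Hence `lam` is optimal for the linear program with `z` frozen.
  have hlow : ∑ i, lam i * y i * w (z i) ≤ ∑ i, lam i * y i * w (x i) :=
    sum_le_sum fun i _ => by
      rw [mul_assoc, mul_assoc]
      exact mul_le_mul_of_nonneg_left (hzmin i _ (hx i)) (h0 i)
  have hfen := StrongDual.apply_le_half_norm_sq w (∑ i, (lam i * y i) • x i)
  simp only [map_sum, map_smul, smul_eq_mul] at hfen
  obtain ⟨b, hb⟩ := exists_multiplier (c := fun i => 1 - y i * w (z i)) hy univ h0 hC (by
    intro μ m1 m3 _ m2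
    have := hw μ ⟨m1, m2.trans hs, m3⟩ z hz
    rw [hval, hval]
    linarith)
  -- The slack is the hinge loss at `z i`, the least one feasible for this `w` and `b`. By the
  -- multiplier identity, its cost equals the linear value at `lam`.
  refine ⟨(w, b, fun i => max (1 - y i * w (z i) - y i * b) 0),
    ⟨fun i => le_max_right _ _, fun i t ht => ?_⟩, ?_⟩
  · have := hzmin i t ht
    have := le_max_left (1 - y i * w (z i) - y i * b) 0
    simp only
    linarith
  · have h1 := hw lam ⟨h0, hs, hC⟩ z hz
    simp only [svmObj, odSvmObj]
    have h2 : C * ∑ i, max (1 - y i * w (z i) - y i * b) 0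
        = ∑ i, lam i * (1 - y i * w (z i)) - b * ∑ i, lam i * y i := by
      rw [mul_sum, mul_sum, ← sum_sub_distrib]
      exact sum_congr rfl fun i hi => by rw [hb i hi]; ring
    rw [h2, hval, hs]
    linarith

/-- Strong duality for the relaxed C-margin pair. -/
lemma exists_cmObj_le_odCmObj (hy : ∀ i, y i = 1 ∨ y i = -1) (hconv : ∀ i, Convex ℝ (K i))
    (hcomp : ∀ i, WeaklyCompact (K i)) {D : ℝ} {lam : Fin m → ℝ} {x : Fin m → X}
    (hsol : IsSolODCM K y D lam x) :
    ∃ p ∈ cmFeasible K y, cmObj D p ≤ odCmObj y (lam, x) := by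
  obtain ⟨⟨h0, hx, hs1, hs2, hD⟩, hmax⟩ := hsol
  simp only at h0 hx hs1 hs2 hD
  have hΛ : Convex ℝ {μ : Fin m → ℝ | (∀ i, 0 ≤ μ i) ∧ ∑ i ∈ posIdx y, μ i = 1 ∧
      ∑ i ∈ negIdx y, μ i = 1 ∧ ∀ i, μ i ≤ D} := by
    rintro μ ⟨m1, m2, m3, m4⟩ ν ⟨n1, n2, n3, n4⟩ a b ha hb hab
    refine ⟨fun i => ?_, ?_, ?_, fun i => ?_⟩
    · exact add_nonneg (mul_nonneg ha (m1 i)) (mul_nonneg hb (n1 i))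
    · simp only [Pi.add_apply, Pi.smul_apply, smul_eq_mul, sum_add_distrib, ← mul_sum, m2, n2,
        mul_one, hab]
    · simp only [Pi.add_apply, Pi.smul_apply, smul_eq_mul, sum_add_distrib, ← mul_sum, m3, n3,
        mul_one, hab]
    · have : a * μ i + b * ν i ≤ a * D + b * D := by gcongr; exacts [m4 i, n4 i]
      rw [← add_mul, hab, one_mul] at this
      exact this
  obtain ⟨w, hw⟩ := exists_dual_of_isMax (y := y) hconv hΛ (fun μ h => h.1) 0
    ⟨h0, hs1, hs2, hD⟩ hx (by
    rintro μ ⟨m1, m2, m3, m4⟩ z hz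
    have := hmax (show (μ, z) ∈ odCmFeasible K y D from ⟨m1, hz, m2, m3, m4⟩)
    simpa [odCmObj] using this)
  simp only [zero_mul, zero_sub] at hw
  obtain ⟨z, hz, hzmin⟩ := exists_forall_label_mul_le (y := y) hcomp (fun i => ⟨x i, hx i⟩) w
  have hval : ∀ μ : Fin m → ℝ, ∑ i, μ i * (-(y i * w (z i)))
      = -∑ i, μ i * y i * w (z i) := fun μ => by
    rw [← sum_neg_distrib]
    exact sum_congr rfl fun i _ => by ring
  have hlow : ∑ i, lam i * y i * w (z i) ≤ ∑ i, lam i * y i * w (x i) :=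
    sum_le_sum fun i _ => by
      rw [mul_assoc, mul_assoc]
      exact mul_le_mul_of_nonneg_left (hzmin i _ (hx i)) (h0 i)
  have hfen := StrongDual.apply_le_half_norm_sq w (∑ i, (lam i * y i) • x i)
  simp only [map_sum, map_smul, smul_eq_mul] at hfen
  have hpos : ∀ μ : Fin m → ℝ, ∑ i ∈ posIdx y, μ i * y i = ∑ i ∈ posIdx y, μ i := fun μ =>
    sum_congr rfl fun i hi => by rw [mem_posIdx.1 hi, mul_one]
  have hneg : ∀ μ : Fin m → ℝ, ∑ i ∈ negIdx y, μ i * y i = -∑ i ∈ negIdx y, μ i := fun μ => by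
    rw [← sum_neg_distrib]
    exact sum_congr rfl fun i hi => by rw [mem_negIdx.1 hi, mul_neg_one]
  have hopt : ∀ μ : Fin m → ℝ, (∀ i, 0 ≤ μ i) → (∀ i, μ i ≤ D) →
      ∑ i ∈ posIdx y, μ i = 1 → ∑ i ∈ negIdx y, μ i = 1 →
      ∑ i, μ i * (-(y i * w (z i))) ≤ ∑ i, lam i * (-(y i * w (z i))) := by
    intro μ m1 m4 m2 m3
    have := hw μ ⟨m1, m2, m3, m4⟩ z hz
    rw [hval, hval]
    linarith
  have hdj : ∀ i, i ∈ posIdx y → i ∉ negIdx y := fun i hi hi' => by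
    have := (mem_posIdx.1 hi).symm.trans (mem_negIdx.1 hi')
    norm_num at this
  -- Each class has its own normalization, hence its own multiplier, found by varying weights in
  -- that class only. The offsets are `α = -b` and `β = -a`.
  obtain ⟨b, hb⟩ := exists_multiplier (c := fun i => -(y i * w (z i))) hy (posIdx y) h0 hD (by
    intro μ m1 m4 m3 m2
    rw [hpos, hpos, hs1] at m2
    refine hopt μ m1 m4 m2 ?_
    rw [← hs2]
    exact sum_congr rfl fun i hi => m3 i fun h => hdj i h hi)
  obtain ⟨a, ha⟩ := exists_multiplier (c := fun i => -(y i * w (z i))) hy (negIdx y) h0 hD (by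
    intro μ m1 m4 m3 m2
    rw [hneg, hneg, hs2, neg_inj] at m2
    refine hopt μ m1 m4 ?_ m2
    rw [← hs1]
    exact sum_congr rfl fun i hi => m3 i fun h => hdj i hi h)
  let ξ : Fin m → ℝ := fun i => max (-(y i * w (z i)) - y i * (if y i = 1 then b else a)) 0
  have hξpos : ∀ i ∈ posIdx y, ξ i = max (-(y i * w (z i)) - y i * b) 0 := fun i hi => by
    simp only [ξ, if_pos (mem_posIdx.1 hi)]
  have hξneg : ∀ i ∈ negIdx y, ξ i = max (-(y i * w (z i)) - y i * a) 0 := fun i hi => by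
    simp only [ξ, if_neg fun h => hdj i (mem_posIdx.2 h) hi]
  refine ⟨(w, -b, -a, ξ), ⟨fun i => le_max_right _ _, fun i hi t ht => ?_, fun i hi t ht => ?_⟩, ?_⟩
  · have h1 := hzmin i t ht
    have h2 := le_max_left (-(y i * w (z i)) - y i * b) 0
    rw [← hξpos i hi] at h2
    rw [mem_posIdx.1 hi] at h1 h2
    simp only
    linarith
  · have h1 := hzmin i t ht
    have h2 := le_max_left (-(y i * w (z i)) - y i * a) 0
    rw [← hξneg i hi] at h2
    rw [mem_negIdx.1 hi] at h1 h2
    simp only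
    linarith
  · have h1 := hw lam ⟨h0, hs1, hs2, hD⟩ z hz
    have e1 : D * ∑ i ∈ posIdx y, ξ i = ∑ i ∈ posIdx y, lam i * (-(y i * w (z i))) - b := by
      have : b = b * ∑ i ∈ posIdx y, lam i * y i := by rw [hpos, hs1, mul_one]
      rw [this, mul_sum, mul_sum, ← sum_sub_distrib]
      exact sum_congr rfl fun i hi => by rw [hξpos i hi, hb i hi]; ring
    have e2 : D * ∑ i ∈ negIdx y, ξ i = ∑ i ∈ negIdx y, lam i * (-(y i * w (z i))) + a := by
      have : a = -(a * ∑ i ∈ negIdx y, lam i * y i) := by rw [hneg, hs2]; ring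
      rw [this, mul_sum, mul_sum, ← sub_eq_add_neg, ← sum_sub_distrib]
      exact sum_congr rfl fun i hi => by rw [hξneg i hi, ha i hi]; ring
    have e3 : D * ∑ i, ξ i = -∑ i, lam i * y i * w (z i) - b + a := by
      rw [← hval, ← sum_posIdx_add_sum_negIdx hy ξ, mul_add, e1, e2,
        ← sum_posIdx_add_sum_negIdx hy (fun i => lam i * (-(y i * w (z i))))]
      ring
    simp only [cmObj, odCmObj]
    rw [e3]
    linarith

/-- By weak duality, each of the two values bounds every competitor of the other, so a closed gap
certifies both. -/
lemma isSolSVM_of_le {C : ℝ} {w : StrongDual ℝ X} {b : ℝ} {ξ lam : Fin m → ℝ} {x : Fin m → X}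
    (hp : (w, b, ξ) ∈ svmFeasible K y) (hq : (lam, x) ∈ odSvmFeasible K y C)
    (h : svmObj C (w, b, ξ) ≤ odSvmObj y (lam, x)) :
    IsSolSVM K y C w b ξ ∧ IsSolODSVM K y C lam x :=
  ⟨⟨hp, fun _ hp' => h.trans (odSvmObj_le_svmObj hq hp')⟩,
    ⟨hq, fun _ hq' => (odSvmObj_le_svmObj hq' hp).trans h⟩⟩

lemma isSolCM_of_le (hy : ∀ i, y i = 1 ∨ y i = -1) {D : ℝ} {w : StrongDual ℝ X} {α β : ℝ}
    {ξ lam : Fin m → ℝ} {x : Fin m → X}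
    (hp : (w, α, β, ξ) ∈ cmFeasible K y) (hq : (lam, x) ∈ odCmFeasible K y D)
    (h : cmObj D (w, α, β, ξ) ≤ odCmObj y (lam, x)) :
    IsSolCM K y D w α β ξ ∧ IsSolODCM K y D lam x :=
  ⟨⟨hp, fun _ hp' => h.trans (odCmObj_le_cmObj hy hq hp')⟩,
    ⟨hq, fun _ hq' => (odCmObj_le_cmObj hy hq' hp).trans h⟩⟩

lemma norm_sum_smul_mul_label (c : ℝ) (lam : Fin m → ℝ) (x : Fin m → X) :
    ‖∑ i, ((c • lam) i * y i) • x i‖ ^ 2 = c ^ 2 * ‖∑ i, (lam i * y i) • x i‖ ^ 2 := by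
  have : ∑ i, ((c • lam) i * y i) • x i = c • ∑ i, (lam i * y i) • x i := by
    rw [smul_sum]
    exact sum_congr rfl fun i _ => by rw [smul_smul, Pi.smul_apply, smul_eq_mul, mul_assoc]
  rw [this, norm_smul, mul_pow, Real.norm_eq_abs, sq_abs]

lemma sum_smul_apply (c : ℝ) (ξ : Fin m → ℝ) (J : Finset (Fin m)) :
    ∑ i ∈ J, (c • ξ) i = c * ∑ i ∈ J, ξ i := by
  rw [mul_sum]
  rfl

/-- Solutions of the soft-margin pair rescale to solutions of the relaxed C-margin pair. -/
lemma isSolCM_of_isSolSVM (hy : ∀ i, y i = 1 ∨ y i = -1) (hconv : ∀ i, Convex ℝ (K i))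
    (hcomp : ∀ i, WeaklyCompact (K i)) {C : ℝ} {w : StrongDual ℝ X} {b : ℝ}
    {ξ lam : Fin m → ℝ} {x : Fin m → X} (hC : 0 < C) (hP : IsSolSVM K y C w b ξ)
    (hQ : IsSolODSVM K y C lam x) (hw : w ≠ 0) :
    0 < ∑ i, lam i ∧
      IsSolCM K y (2 * C / ∑ i, lam i) ((2 / ∑ i, lam i) • w) (2 * (1 - b) / ∑ i, lam i)
        (2 * (-1 - b) / ∑ i, lam i) ((2 / ∑ i, lam i) • ξ) ∧
      IsSolODCM K y (2 * C / ∑ i, lam i) ((2 / ∑ i, lam i) • lam) x := by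
  obtain ⟨p, hp, hpq⟩ := exists_svmObj_le_odSvmObj hy hconv hcomp hQ
  have hval : svmObj C (w, b, ξ) ≤ odSvmObj y (lam, x) := (hP.2 hp).trans hpq
  obtain ⟨⟨hξ, hc⟩, -⟩ := hP
  obtain ⟨⟨h0, hx, hs, hlC⟩, -⟩ := hQ
  simp only [svmObj, odSvmObj] at hξ hc h0 hx hs hlC hval
  have hw2 : 0 < ‖w‖ ^ 2 := by positivity
  have hξ0 : 0 ≤ C * ∑ i, ξ i := mul_nonneg hC.le (sum_nonneg fun i _ => hξ i)
  have hsum := sum_posIdx_add_sum_negIdx hy lam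
  rw [sum_mul_label hy] at hs
  set σ := ∑ i, lam i with hσ
  -- The closed gap gives `‖w‖² / 2 ≤ σ`.
  have hσ0 : 0 < σ := by
    have := sq_nonneg ‖∑ i, (lam i * y i) • x i‖
    linarith
  have hk : 0 < 2 / σ := by positivity
  refine ⟨hσ0, isSolCM_of_le hy ⟨fun i => ?_, fun i hi t ht => ?_, fun i hi t ht => ?_⟩
    ⟨fun i => ?_, hx, ?_, ?_, fun i => ?_⟩ ?_⟩
  · exact mul_nonneg hk.le (hξ i)
  · have h1 := hc i t ht
    rw [mem_posIdx.1 hi] at h1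
    have h2 := mul_le_mul_of_nonneg_left (show 1 - b - ξ i ≤ w t by linarith) hk.le
    simp only [smul_apply, Pi.smul_apply, smul_eq_mul]
    linear_combination h2
  · have h1 := hc i t ht
    rw [mem_negIdx.1 hi] at h1
    have h2 := mul_le_mul_of_nonneg_left (show w t ≤ -1 - b + ξ i by linarith) hk.le
    simp only [smul_apply, Pi.smul_apply, smul_eq_mul]
    linear_combination h2
  · exact mul_nonneg hk.le (h0 i)
  -- The balance constraint gives each class total weight `σ / 2`, whence the factor `2 / σ`.
  · rw [sum_smul_apply, div_mul_eq_mul_div, div_eq_one_iff_eq hσ0.ne']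
    linarith
  · rw [sum_smul_apply, div_mul_eq_mul_div, div_eq_one_iff_eq hσ0.ne']
    linarith
  · have := mul_le_mul_of_nonneg_left (hlC i) hk.le
    simp only [Pi.smul_apply, smul_eq_mul]
    linear_combination this
  · simp only [cmObj, odCmObj, norm_sum_smul_mul_label, sum_smul_apply, norm_smul, mul_pow,
      Real.norm_eq_abs, sq_abs]
    have h1 := mul_le_mul_of_nonneg_left hval (sq_nonneg (2 / σ))
    -- The new margin term is the old `∑ lam i` times `(2 / σ)²`, so the whole gap scales by that
    -- square.
    have h2 : 2 * (1 - b) / σ - 2 * (-1 - b) / σ = (2 / σ) ^ 2 * σ := by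
      field_simp
      ring
    rw [h2]
    linear_combination h1

/-- Solutions of the relaxed C-margin pair rescale to solutions of the soft-margin pair. -/
lemma isSolSVM_of_isSolCM (hy : ∀ i, y i = 1 ∨ y i = -1) (hconv : ∀ i, Convex ℝ (K i))
    (hcomp : ∀ i, WeaklyCompact (K i)) {D : ℝ} {w : StrongDual ℝ X} {α β : ℝ}
    {ξ lam : Fin m → ℝ} {x : Fin m → X} (hD : 0 < D) (hP : IsSolCM K y D w α β ξ)
    (hQ : IsSolODCM K y D lam x) (hw : w ≠ 0) :
    0 < α - β ∧
      IsSolSVM K y (2 * D / (α - β)) ((2 / (α - β)) • w) (-((α + β) / (α - β)))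
        ((2 / (α - β)) • ξ) ∧
      IsSolODSVM K y (2 * D / (α - β)) ((2 / (α - β)) • lam) x := by
  obtain ⟨p, hp, hpq⟩ := exists_cmObj_le_odCmObj hy hconv hcomp hQ
  have hval : cmObj D (w, α, β, ξ) ≤ odCmObj y (lam, x) := (hP.2 hp).trans hpq
  obtain ⟨⟨hξ, hc1, hc2⟩, -⟩ := hP
  obtain ⟨⟨h0, hx, hs1, hs2, hlD⟩, -⟩ := hQ
  simp only [cmObj, odCmObj] at hξ hc1 hc2 h0 hx hs1 hs2 hlD hval
  have hw2 : 0 < ‖w‖ ^ 2 := by positivity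
  have hξ0 : 0 ≤ D * ∑ i, ξ i := mul_nonneg hD.le (sum_nonneg fun i _ => hξ i)
  have hsum := sum_posIdx_add_sum_negIdx hy lam
  have hσ0 : 0 < α - β := by
    have := sq_nonneg ‖∑ i, (lam i * y i) • x i‖
    linarith
  have hk : 0 < 2 / (α - β) := by positivity
  have hk1 : 2 / (α - β) * (α - β) = 2 := div_mul_cancel₀ _ hσ0.ne'
  have hb : (α + β) / (α - β) = 2 / (α - β) * ((α + β) / 2) := by
    field_simp
  refine ⟨hσ0, isSolSVM_of_le ⟨fun i => ?_, fun i t ht => ?_⟩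
    ⟨fun i => ?_, hx, ?_, fun i => ?_⟩ ?_⟩
  · exact mul_nonneg hk.le (hξ i)
  -- Centring at `(α + β) / 2` puts both thresholds at distance `(α - β) / 2`, which the scaling
  -- turns into `1`.
  · simp only [smul_apply, Pi.smul_apply, smul_eq_mul]
    rw [hb]
    rcases hy i with e | e <;> rw [e]
    · have h2 := mul_le_mul_of_nonneg_left (hc1 i (mem_posIdx.2 e) t ht) hk.le
      linear_combination h2 - hk1 / 2
    · have h2 := mul_le_mul_of_nonneg_left (hc2 i (mem_negIdx.2 e) t ht) hk.le
      linear_combination h2 - hk1 / 2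
  · exact mul_nonneg hk.le (h0 i)
  · rw [sum_mul_label hy, sum_smul_apply, sum_smul_apply, hs1, hs2, sub_self]
  · have := mul_le_mul_of_nonneg_left (hlD i) hk.le
    simp only [Pi.smul_apply, smul_eq_mul]
    linear_combination this
  · simp only [svmObj, odSvmObj, norm_sum_smul_mul_label, sum_smul_apply, norm_smul, mul_pow,
      Real.norm_eq_abs, sq_abs]
    rw [← hsum, hs1, hs2]
    have h1 := mul_le_mul_of_nonneg_left hval (sq_nonneg (2 / (α - β)))
    -- The rescaled weights sum to `2 * k = k² * (α - β)` for `k = 2 / (α - β)`, so the gap scales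
    -- by `k²`.
    linear_combination h1 + 2 / (α - β) * hk1

end Duality

/-! ### Distance between two sets -/

section SetDist

variable {X : Type*} [NormedAddCommGroup X]

lemma setDist_le {A B : Set X} {p q : X} (hp : p ∈ A) (hq : q ∈ B) : setDist A B ≤ ‖p - q‖ :=
  csInf_le ⟨0, by rintro _ ⟨p, _, q, _, rfl⟩; exact norm_nonneg _⟩ ⟨p, hp, q, hq, rfl⟩

lemma le_setDist {A B : Set X} {r : ℝ} (hA : A.Nonempty) (hB : B.Nonempty)
    (h : ∀ p ∈ A, ∀ q ∈ B, r ≤ ‖p - q‖) : r ≤ setDist A B := by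
  obtain ⟨p, hp⟩ := hA
  obtain ⟨q, hq⟩ := hB
  refine le_csInf ⟨_, p, hp, q, hq, rfl⟩ ?_
  rintro _ ⟨p, hp, q, hq, rfl⟩
  exact h p hp q hq

lemma setDist_nonneg (A B : Set X) : 0 ≤ setDist A B :=
  Real.sInf_nonneg (by rintro _ ⟨p, _, q, _, rfl⟩; exact norm_nonneg _)

end SetDist

/-! ### The relaxed dual as a nearest-point problem -/

section NearestPoints

variable {X : Type*} [NormedAddCommGroup X] [NormedSpace ℝ X] {m : ℕ}
  {K : Fin m → Set X} {y : Fin m → ℝ} {D : ℝ}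

lemma sum_mem_reducedHull {lam : Fin m → ℝ} {x : Fin m → X}
    (h : (lam, x) ∈ odCmFeasible K y D) :
    ∑ i ∈ posIdx y, lam i • x i ∈ reducedHull K (posIdx y) D ∧
      ∑ i ∈ negIdx y, lam i • x i ∈ reducedHull K (negIdx y) D := by
  obtain ⟨h0, hx, hs1, hs2, hD⟩ := h
  exact ⟨⟨lam, x, fun i _ => ⟨hx i, h0 i, hD i⟩, hs1, rfl⟩,
    ⟨lam, x, fun i _ => ⟨hx i, h0 i, hD i⟩, hs2, rfl⟩⟩

/-- The two representations use disjoint index sets that together exhaust all indices, so they glue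
to one family. -/
lemma exists_odCmFeasible_of_mem_reducedHull (hy : ∀ i, y i = 1 ∨ y i = -1) {p q : X}
    (hp : p ∈ reducedHull K (posIdx y) D) (hq : q ∈ reducedHull K (negIdx y) D) :
    ∃ (lam : Fin m → ℝ) (x : Fin m → X), (lam, x) ∈ odCmFeasible K y D ∧
      p = ∑ i ∈ posIdx y, lam i • x i ∧ q = ∑ i ∈ negIdx y, lam i • x i := by
  obtain ⟨a, x, hax, ha, rfl⟩ := hp
  obtain ⟨b, z, hbz, hb, rfl⟩ := hq
  let lam : Fin m → ℝ := fun i => if y i = 1 then a i else b i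
  let u : Fin m → X := fun i => if y i = 1 then x i else z i
  have hpos : ∀ i ∈ posIdx y, lam i = a i ∧ u i = x i := fun i hi => by
    simp [lam, u, mem_posIdx.1 hi]
  have hneg : ∀ i ∈ negIdx y, lam i = b i ∧ u i = z i := fun i hi => by
    have : y i ≠ 1 := by rw [mem_negIdx.1 hi]; norm_num
    simp [lam, u, this]
  have hall : ∀ i, u i ∈ K i ∧ 0 ≤ lam i ∧ lam i ≤ D := fun i => by
    rcases hy i with h | h
    · rw [(hpos i (mem_posIdx.2 h)).1, (hpos i (mem_posIdx.2 h)).2]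
      exact hax i (mem_posIdx.2 h)
    · rw [(hneg i (mem_negIdx.2 h)).1, (hneg i (mem_negIdx.2 h)).2]
      exact hbz i (mem_negIdx.2 h)
  refine ⟨lam, u, ⟨fun i => (hall i).2.1, fun i => (hall i).1, ?_, ?_, fun i => (hall i).2.2⟩,
    sum_congr rfl fun i hi => ?_, sum_congr rfl fun i hi => ?_⟩
  · rw [← ha]
    exact sum_congr rfl fun i hi => (hpos i hi).1
  · rw [← hb]
    exact sum_congr rfl fun i hi => (hneg i hi).1
  · rw [(hpos i hi).1, (hpos i hi).2]
  · rw [(hneg i hi).1, (hneg i hi).2]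

lemma odCmObj_eq (hy : ∀ i, y i = 1 ∨ y i = -1) (lam : Fin m → ℝ) (x : Fin m → X) :
    odCmObj y (lam, x) =
      -(1 / 2 * ‖∑ i ∈ posIdx y, lam i • x i - ∑ i ∈ negIdx y, lam i • x i‖ ^ 2) := by
  simp only [odCmObj]
  rw [sum_mul_label_smul hy]

lemma isLUB_odCmObj (hy : ∀ i, y i = 1 ∨ y i = -1)
    (hpos : (reducedHull K (posIdx y) D).Nonempty) (hneg : (reducedHull K (negIdx y) D).Nonempty) :
    IsLUB (odCmObj y '' odCmFeasible K y D)
      (-(1 / 2 * setDist (reducedHull K (posIdx y) D) (reducedHull K (negIdx y) D) ^ 2)) := by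
  constructor
  · rintro _ ⟨⟨lam, x⟩, h, rfl⟩
    have := pow_le_pow_left₀ (setDist_nonneg _ _)
      (setDist_le (sum_mem_reducedHull h).1 (sum_mem_reducedHull h).2) 2
    rw [odCmObj_eq hy]
    linarith
  · intro c hc
    -- Taking the root turns an upper bound `c` into a lower bound for all distances, so attainment
    -- is not needed. For positive `c` the root is `0`, which is harmless.
    have h : √(-2 * c) ≤ setDist (reducedHull K (posIdx y) D) (reducedHull K (negIdx y) D) := by
      refine le_setDist hpos hneg fun p hp q hq => ?_
      obtain ⟨lam, x, hf, rfl, rfl⟩ := exists_odCmFeasible_of_mem_reducedHull hy hp hq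
      have := hc ⟨_, hf, rfl⟩
      rw [odCmObj_eq hy] at this
      exact Real.sqrt_le_left (norm_nonneg _) |>.2 (by linarith)
    rw [Real.sqrt_le_left (setDist_nonneg _ _)] at h
    linarith

lemma isSolODCM_iff_isNearestPair (hy : ∀ i, y i = 1 ∨ y i = -1) {lam : Fin m → ℝ}
    {x : Fin m → X} (hf : (lam, x) ∈ odCmFeasible K y D) :
    IsSolODCM K y D lam x ↔
      IsNearestPair (reducedHull K (posIdx y) D) (reducedHull K (negIdx y) D)
        (∑ i ∈ posIdx y, lam i • x i) (∑ i ∈ negIdx y, lam i • x i) := by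
  obtain ⟨hp, hq⟩ := sum_mem_reducedHull hf
  constructor
  · rintro ⟨-, hmax⟩
    refine ⟨hp, hq, le_antisymm (le_setDist ⟨_, hp⟩ ⟨_, hq⟩ fun p' hp' q' hq' => ?_)
      (setDist_le hp hq)⟩
    obtain ⟨μ, z, hf', rfl, rfl⟩ := exists_odCmFeasible_of_mem_reducedHull hy hp' hq'
    have : odCmObj y (μ, z) ≤ odCmObj y (lam, x) := hmax hf'
    rw [odCmObj_eq hy, odCmObj_eq hy] at this
    exact le_of_sq_le_sq (by linarith) (norm_nonneg _)
  · rintro ⟨-, -, hd⟩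
    refine ⟨hf, ?_⟩
    rintro ⟨μ, z⟩ hf'
    have h1 := setDist_le (sum_mem_reducedHull hf').1 (sum_mem_reducedHull hf').2
    rw [← hd] at h1
    have := pow_le_pow_left₀ (norm_nonneg _) h1 2
    simp only [Set.mem_ofPred_eq]
    rw [odCmObj_eq hy, odCmObj_eq hy]
    linarith

end NearestPoints

end RobustSVM

theorem mainTheorem6 {X : Type*} [NormedAddCommGroup X] [NormedSpace ℝ X] [CompleteSpace X]
    {m : ℕ} (K : Fin m → Set X) (y : Fin m → ℝ) (hy : ∀ i, y i = 1 ∨ y i = -1)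
    (hconv : ∀ i, Convex ℝ (K i)) (hcomp : ∀ i, RobustSVM.WeaklyCompact (K i)) :
    -- from the soft-margin pair to the relaxed C-margin pair
    (∀ (C : ℝ) (w : StrongDual ℝ X) (b : ℝ) (ξ lam : Fin m → ℝ) (x : Fin m → X),
      0 < C → RobustSVM.IsSolSVM K y C w b ξ → RobustSVM.IsSolODSVM K y C lam x → w ≠ 0 →
        0 < ∑ i, lam i ∧
        RobustSVM.IsSolCM K y (2 * C / ∑ i, lam i)
          ((2 / ∑ i, lam i) • w) (2 * (1 - b) / ∑ i, lam i) (2 * (-1 - b) / ∑ i, lam i)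
          ((2 / ∑ i, lam i) • ξ) ∧
        RobustSVM.IsSolODCM K y (2 * C / ∑ i, lam i) ((2 / ∑ i, lam i) • lam) x) ∧
    -- from the relaxed C-margin pair to the soft-margin pair
    (∀ (D : ℝ) (w : StrongDual ℝ X) (α β : ℝ) (ξ lam : Fin m → ℝ) (x : Fin m → X),
      0 < D → RobustSVM.IsSolCM K y D w α β ξ → RobustSVM.IsSolODCM K y D lam x → w ≠ 0 →
        0 < α - β ∧
        RobustSVM.IsSolSVM K y (2 * D / (α - β))
          ((2 / (α - β)) • w) (-((α + β) / (α - β))) ((2 / (α - β)) • ξ) ∧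
        RobustSVM.IsSolODSVM K y (2 * D / (α - β)) ((2 / (α - β)) • lam) x) ∧
    -- the dual is the nearest-point problem between the reduced convex hulls
    (∀ D : ℝ, 0 < D →
      -- same optimal value, up to the factor -1/2 and the square
      ((RobustSVM.reducedHull K (RobustSVM.posIdx y) D).Nonempty →
        (RobustSVM.reducedHull K (RobustSVM.negIdx y) D).Nonempty →
        IsLUB (RobustSVM.odCmObj y '' RobustSVM.odCmFeasible K y D)
          (-(1 / 2 * RobustSVM.setDist (RobustSVM.reducedHull K (RobustSVM.posIdx y) D)
            (RobustSVM.reducedHull K (RobustSVM.negIdx y) D) ^ 2))) ∧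
      -- a feasible point is a dual solution exactly when it gives a nearest pair
      (∀ (lam : Fin m → ℝ) (x : Fin m → X), (lam, x) ∈ RobustSVM.odCmFeasible K y D →
        (RobustSVM.IsSolODCM K y D lam x ↔
          RobustSVM.IsNearestPair (RobustSVM.reducedHull K (RobustSVM.posIdx y) D)
            (RobustSVM.reducedHull K (RobustSVM.negIdx y) D)
            (∑ i ∈ RobustSVM.posIdx y, lam i • x i) (∑ i ∈ RobustSVM.negIdx y, lam i • x i))) ∧
      -- every nearest pair comes from a dual solution
      (∀ p q : X, RobustSVM.IsNearestPair (RobustSVM.reducedHull K (RobustSVM.posIdx y) D)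
          (RobustSVM.reducedHull K (RobustSVM.negIdx y) D) p q →
        ∃ (lam : Fin m → ℝ) (x : Fin m → X), RobustSVM.IsSolODCM K y D lam x ∧
          p = ∑ i ∈ RobustSVM.posIdx y, lam i • x i ∧
          q = ∑ i ∈ RobustSVM.negIdx y, lam i • x i)) := by
  refine ⟨fun C w b ξ lam x hC hP hQ hw =>
      RobustSVM.isSolCM_of_isSolSVM hy hconv hcomp hC hP hQ hw,
    fun D w α β ξ lam x hD hP hQ hw =>
      RobustSVM.isSolSVM_of_isSolCM hy hconv hcomp hD hP hQ hw,
    fun D _ => ⟨RobustSVM.isLUB_odCmObj hy,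
      fun lam x hf => RobustSVM.isSolODCM_iff_isNearestPair hy hf, fun p q h => ?_⟩⟩
  obtain ⟨lam, x, hf, rfl, rfl⟩ :=
    RobustSVM.exists_odCmFeasible_of_mem_reducedHull hy h.1 h.2.1
  exact ⟨lam, x, (RobustSVM.isSolODCM_iff_isNearestPair hy hf).2 h, rfl, rfl⟩
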